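/- **Lemma 5.2.** Let $n\ge 2$ and let $g:\mathbb R^n\times S^{n-1}\to S^{n-1}$ be the projection. Let $(\widetilde M_i)_{i\in\mathbb N}$ be a sequence of subsets of $\mathbb R^n\times S^{n-1}$ of uniformly bounded mass, $\sup_i \mathcal H^{n-1}(\widetilde M_i)<\infty$ (for instance the outward vector lifts, filled in or not, of a sequence of sets in $\mathbb R^n$). For a unit vector $v$ write $\Sigma_v=\{x\in S^{n-1}: x\cdot v=0\}$ for the great sphere with poles $\pm v$. Then there are a finite set $V\subset S^{n-1}$ of poles, a subsequence $(\widetilde M_{i_j})_j$ and a constant $C<\infty$ such that, with $S=\bigcup_{v\in V}\Sigma_v$: 1. every connected component ($(n-1)$-cell) of $S^{n-1}\setminus S$ has geodesic diameter less than $1$; 2. $\mathcal H^{n-2}\big(\widetilde M_{i_j}\cap g^{-1}(S)\big)\le C$ for all $j$; 3. for every $W\subseteq V$ and every $1\le k\le n-1$ such that the intersection $\bigcap_{v\in W}\Sigma_v$ has codimension $k$ in $S^{n-1}$ (that is, $\dim\operatorname{span}W=k$, so that the intersection is a great sphere of dimension $n-1-k$), $$\mathcal H^{n-1-k}\Big(\widetilde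 M_{i_j}\cap g^{-1}\Big(\bigcap_{v\in W}\Sigma_v\Big)\Big)\le C\qquad\text{for all } j.$$ -/

import Mathlib

open MeasureTheory Metric
open scoped ENNReal NNReal

/-- Euclidean space `ℝⁿ`. -/
abbrev Eucl (n : ℕ) : Type := EuclideanSpace ℝ (Fin n)

/-- The unit sphere `S^{n-1}` of `ℝⁿ`. -/
abbrev USphere (n : ℕ) : Type := sphere (0 : Eucl n) 1

/-- The trivial sphere bundle `ℝⁿ × S^{n-1}`, with the Euclidean (`ℓ²`) product metric. -/
abbrev SphereBundle (n : ℕ) : Type := WithLp 2 (Eucl n × USphere n)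

/-- The projection `g : ℝⁿ × S^{n-1} → S^{n-1}`. -/
def bundleProj {n : ℕ} (p : SphereBundle n) : USphere n := p.snd

/-- The part of `E ⊆ ℝⁿ × S^{n-1}` lying over `A ⊆ S^{n-1}`, i.e. the pull-back of `A` to `E`. -/
def pullBack {n : ℕ} (E : Set (SphereBundle n)) (A : Set (USphere n)) : Set (SphereBundle n) :=
  E ∩ bundleProj ⁻¹' A

/-- The great sphere (of dimension `n - 2`) of `S^{n-1}` with poles `± v`. -/
def greatSphere {n : ℕ} (v : USphere n) : Set (USphere n) :=
  {x | inner ℝ (v : Eucl n) (x : Eucl n) = 0}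

/-- The `(n-2)`-skeleton cut out on `S^{n-1}` by finitely many great spheres, given by poles:
the union of these great spheres. -/
def greatSkeleton {n : ℕ} (V : Finset (USphere n)) : Set (USphere n) :=
  ⋃ v ∈ V, greatSphere v

/-- The common intersection of the great spheres with poles in `W`. -/
def greatIntersection {n : ℕ} (W : Finset (USphere n)) : Set (USphere n) :=
  ⋂ v ∈ W, greatSphere v

/-- The codimension in `S^{n-1}` of the intersection of the great spheres with poles in `W`:
the intersection is the unit sphere of the orthogonal complement of the span of `W`. -/
noncomputable def greatCodim {n : ℕ} (W : Finset (USphere n)) : ℕ :=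
  Module.finrank ℝ (Submodule.span ℝ ((fun v : USphere n => (v : Eucl n)) '' (W : Set (USphere n))))

/-- The diameter of a subset of `S^{n-1}` for the geodesic (angular) distance, which is at least
the diameter for the chordal distance. -/
noncomputable def geodesicDiam {n : ℕ} (A : Set (USphere n)) : ℝ≥0∞ :=
  ⨆ x ∈ A, ⨆ y ∈ A, ENNReal.ofReal (InnerProductGeometry.angle (x : Eucl n) (y : Eucl n))

/-- The `(n-1)`-cells of a skeleton `S`: the connected components of `S^{n-1} \ S`. -/
def skeletonCells {n : ℕ} (S : Set (USphere n)) : Set (Set (USphere n)) :=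
  {c | ∃ x ∈ Sᶜ, c = connectedComponentIn Sᶜ x}

/-! Poles are chosen one at a time, each near a point of a fine net. An Eilenberg inequality
(`exists_slice_majorant`) bounds the integral, over normals near the given point, of the slice
measures of a set by its own measure in one dimension higher. Fatou's lemma along the sequence then
gives a normal where the slice bounds have finite liminf, hence a subsequence with bounded slices.
Slicing simultaneously all intersections of the poles already chosen keeps each of them under
control (`exists_poles_subseq_pullBack_le`). Density of the poles makes the cells small, since two
distant points are separated by a great sphere whose pole nearly points along their difference.
Dependent poles are handled by passing to a basis of their span. -/

/-! ### An Eilenberg inequality for hyperplane slices -/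

theorem volume_slab_le {n : ℕ} (x : USphere n) (δ : ℝ) :
    volume {w : Eucl n | ‖w‖ ≤ 2 ∧ |inner ℝ (x : Eucl n) w| ≤ 2 * δ} ≤
      4 ^ n * ENNReal.ofReal δ := by
  have hx : ‖(x : Eucl n)‖ = 1 := norm_eq_of_mem_sphere x
  obtain rfl | hn := Nat.eq_zero_or_pos n
  · have : (x : Eucl 0) = 0 := Subsingleton.elim _ _
    simp [this] at hx
  -- In an orthonormal basis starting with `x`, the set lies in a box with one side `4 * δ` and all
  -- others `4`.
  obtain ⟨b, hb⟩ := Orthonormal.exists_orthonormalBasis_extension_of_card_eq (𝕜 := ℝ)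
    (E := Eucl n) (ι := Fin n) (by simp) (v := fun _ => (x : Eucl n)) (s := {⟨0, hn⟩})
    ⟨fun i => hx, fun i j hij => (hij (Subsingleton.elim _ _)).elim⟩
  have hb0 := hb ⟨0, hn⟩ rfl
  set i₀ : Fin n := ⟨0, hn⟩
  let r : Fin n → ℝ := fun i => if i = i₀ then 2 * δ else 2
  have hmp := (PiLp.volume_preserving_ofLp (Fin n)).comp b.measurePreserving_repr
  calc volume {w : Eucl n | ‖w‖ ≤ 2 ∧ |inner ℝ (x : Eucl n) w| ≤ 2 * δ}
      ≤ volume ((WithLp.ofLp ∘ b.repr) ⁻¹' Set.Icc (-r) r) := by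
        refine measure_mono fun w hw => ?_
        have key : ∀ i, |b.repr w i| ≤ r i := by
          intro i
          by_cases hi : i = i₀
          · subst hi
            simp only [r, if_true]
            rw [b.repr_apply_apply, hb0]
            exact hw.2
          · simp only [r, if_neg hi]
            rw [b.repr_apply_apply]
            refine (abs_real_inner_le_norm _ _).trans ?_
            rw [b.norm_eq_one, one_mul]
            exact hw.1
        exact ⟨fun i => (abs_le.1 (key i)).1, fun i => (abs_le.1 (key i)).2⟩
    _ = volume (Set.Icc (-r) r) := hmp.measure_preimage measurableSet_Icc.nullMeasurableSet
    _ = ∏ i, ENNReal.ofReal (r i - (-r) i) := Real.volume_Icc_pi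
    _ = ENNReal.ofReal (4 * δ) * ∏ i ∈ Finset.univ.erase i₀, ENNReal.ofReal 4 := by
        rw [← Finset.mul_prod_erase _ _ (Finset.mem_univ i₀)]
        congr 1
        · simp only [r, Pi.neg_apply, if_true]; congr 1; ring
        · refine Finset.prod_congr rfl fun i hi => ?_
          simp only [r, Pi.neg_apply, if_neg (Finset.ne_of_mem_erase hi)]; congr 1; norm_num
    _ = 4 ^ n * ENNReal.ofReal δ := by
        rw [Finset.prod_const, Finset.card_erase_of_mem (Finset.mem_univ _), Finset.card_univ,
          Fintype.card_fin, ENNReal.ofReal_mul (by norm_num)]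
        obtain ⟨k, rfl⟩ := Nat.exists_eq_succ_of_ne_zero hn.ne'
        simp only [Nat.succ_eq_add_one, Nat.add_sub_cancel, ENNReal.ofReal_ofNat]
        ring

/-- The normal vectors of the hyperplanes that meet `g(B)`. -/
def normalsMeeting {n : ℕ} (B : Set (SphereBundle n)) : Set (Eucl n) :=
  {w | ∃ p ∈ B, inner ℝ w (bundleProj p : Eucl n) = 0}

/-- The part of `A` lying over the hyperplane orthogonal to `w`. -/
def hyperplaneSlice {n : ℕ} (A : Set (SphereBundle n)) (w : Eucl n) : Set (SphereBundle n) :=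
  {p ∈ A | inner ℝ w (bundleProj p : Eucl n) = 0}

theorem dist_bundleProj_le {n : ℕ} (p q : SphereBundle n) :
    dist (bundleProj p : Eucl n) (bundleProj q) ≤ dist p q :=
  WithLp.dist_snd_le p q

/-- Fix one point of `g(B)`. A normal orthogonal to any other point of `g(B)` has inner product at
most `2 * ediam B` with the fixed one, so it lies in a thin slab. -/
theorem volume_normalsMeeting_le {n : ℕ} (u : USphere n) (B : Set (SphereBundle n))
    (hB : ediam B ≠ ⊤) :
    volume.restrict (ball (u : Eucl n) 1) (normalsMeeting B) ≤ 4 ^ n * ediam B := by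
  rw [Measure.restrict_apply' measurableSet_ball]
  obtain rfl | ⟨p, hp⟩ := B.eq_empty_or_nonempty
  · simp [normalsMeeting]
  refine (measure_mono ?_).trans ((volume_slab_le (bundleProj p)
    (ediam B).toReal).trans_eq (by rw [ENNReal.ofReal_toReal hB]))
  rintro w ⟨⟨q, hq, hqw⟩, hw⟩
  have hw2 : ‖w‖ ≤ 2 := by
    have h1 : ‖(u : Eucl n)‖ = 1 := norm_eq_of_mem_sphere u
    have h2 : ‖w - u‖ < 1 := by rwa [mem_ball, dist_eq_norm] at hw
    have h3 : w = (w - u) + u := by abel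
    rw [h3]
    exact (norm_add_le _ _).trans (by linarith)
  refine ⟨hw2, ?_⟩
  have hd : dist (bundleProj p : Eucl n) (bundleProj q) ≤ (ediam B).toReal := by
    refine (dist_bundleProj_le p q).trans ?_
    rw [dist_edist]
    exact ENNReal.toReal_mono hB (edist_le_ediam_of_mem hp hq)
  have : inner ℝ (bundleProj p : Eucl n) w =
      inner ℝ w ((bundleProj p : Eucl n) - bundleProj q) := by
    rw [inner_sub_right, hqw, sub_zero, real_inner_comm]
  rw [this]
  refine (abs_real_inner_le_norm _ _).trans ?_
  rw [← dist_eq_norm]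
  exact mul_le_mul hw2 hd dist_nonneg zero_le_two

theorem exists_cover_of_hausdorffMeasure_le {X : Type*} [EMetricSpace X] [MeasurableSpace X]
    [BorelSpace X] {m : ℝ} (hm : 0 < m) {A : Set X} {C : ℝ≥0} (hA : μH[m] A ≤ C)
    {r : ℝ≥0∞} (hr : 0 < r) :
    ∃ t : ℕ → Set X, A ⊆ ⋃ j, t j ∧ (∀ j, ediam (t j) ≤ r) ∧ ∑' j, ediam (t j) ^ m ≤ C + 1 := by
  -- The slack `1` makes the bound strict, so some cover achieves it.
  have hlt : μH[m] A < C + 1 := hA.trans_lt (ENNReal.lt_add_right ENNReal.coe_ne_top one_ne_zero)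
  rw [Measure.hausdorffMeasure_apply] at hlt
  have hlt' := (le_iSup₂ (f := fun (r : ℝ≥0∞) (_ : 0 < r) =>
    ⨅ (t : ℕ → Set X) (_ : A ⊆ ⋃ n, t n) (_ : ∀ n, ediam (t n) ≤ r),
      ∑' n, ⨆ _ : (t n).Nonempty, ediam (t n) ^ m) r hr).trans_lt hlt
  simp only [iInf_lt_iff] at hlt'
  obtain ⟨t, hAt, htr, hsum⟩ := hlt'
  refine ⟨t, hAt, htr, le_trans (ENNReal.tsum_le_tsum fun j => ?_) hsum.le⟩
  obtain h | h := (t j).eq_empty_or_nonempty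
  · simp [h, hm]
  · simp [h]

/-- An Eilenberg-type inequality: the slices of `A` by hyperplanes have measures bounded by a
measurable function of the normal vector with controlled integral. -/
theorem exists_slice_majorant {n : ℕ} (u : USphere n) {m : ℝ} (hm : 1 ≤ m)
    {A : Set (SphereBundle n)} {C : ℝ≥0} (hA : μH[m] A ≤ C) :
    ∃ h : Eucl n → ℝ≥0∞, Measurable h ∧ (∀ w, μH[m - 1] (hyperplaneSlice A w) ≤ h w) ∧
      ∫⁻ w in ball (u : Eucl n) 1, h w ≤ 4 ^ n * (C + 1) := by
  have hr : ∀ p : ℕ, (0 : ℝ≥0∞) < ((p : ℝ≥0∞) + 1)⁻¹ := fun p => by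
    simp [ENNReal.add_eq_top]
  have hr' : Filter.Tendsto (fun p : ℕ => ((p : ℝ≥0∞) + 1)⁻¹) Filter.atTop (nhds 0) := by
    have := (Filter.tendsto_add_atTop_iff_nat 1).2 ENNReal.tendsto_inv_nat_nhds_zero
    simpa using this
  choose t hAt htr hsum using fun p : ℕ =>
    exists_cover_of_hausdorffMeasure_le (zero_lt_one.trans_le hm) hA (hr p)
  have htop : ∀ p j, ediam (t p j) ≠ ⊤ := fun p j =>
    ((htr p j).trans_lt (ENNReal.inv_lt_top.2 (by positivity))).ne
  set μ : Measure (Eucl n) := volume.restrict (ball (u : Eucl n) 1) with hμ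
  -- The covering sets are arbitrary; measurable hulls have the same measure and keep the majorant
  -- measurable.
  let M : ℕ → ℕ → Set (Eucl n) := fun p j => toMeasurable μ (normalsMeeting (t p j))
  have hM : ∀ p j, MeasurableSet (M p j) := fun p j => measurableSet_toMeasurable _ _
  let f : ℕ → Eucl n → ℝ≥0∞ := fun p w =>
    ∑' j, (M p j).indicator (fun _ => ediam (t p j) ^ (m - 1)) w
  have hf : ∀ p, Measurable (f p) := fun p =>
    Measurable.tsum fun j => measurable_const.indicator (hM p j)
  have hfint : ∀ p, ∫⁻ w, f p w ∂μ ≤ 4 ^ n * (C + 1) := by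
    intro p
    simp only [f]
    rw [lintegral_tsum fun j => (measurable_const.indicator (hM p j)).aemeasurable]
    calc ∑' j, ∫⁻ w, (M p j).indicator (fun _ => ediam (t p j) ^ (m - 1)) w ∂μ
        ≤ ∑' j, 4 ^ n * ediam (t p j) ^ m := by
          refine ENNReal.tsum_le_tsum fun j => ?_
          rw [lintegral_indicator_const (hM p j), measure_toMeasurable]
          calc ediam (t p j) ^ (m - 1) * μ (normalsMeeting (t p j))
              ≤ ediam (t p j) ^ (m - 1) * (4 ^ n * ediam (t p j)) := by
                gcongr
                exact volume_normalsMeeting_le u _ (htop p j)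
            _ = 4 ^ n * (ediam (t p j) ^ (m - 1) * ediam (t p j) ^ (1 : ℝ)) := by
                rw [ENNReal.rpow_one]; ring
            _ = 4 ^ n * ediam (t p j) ^ m := by
                rw [← ENNReal.rpow_add_of_nonneg _ _ (by linarith) zero_le_one, sub_add_cancel]
      _ ≤ 4 ^ n * (C + 1) := by
          rw [ENNReal.tsum_mul_left]
          gcongr
          exact hsum p
  -- For each `w`, the covering sets whose hull contains `w` cover the slice, with diameters tending
  -- to zero.
  refine ⟨fun w => Filter.liminf (fun p => f p w) Filter.atTop, Measurable.liminf hf, ?_, ?_⟩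
  · intro w
    have := Measure.hausdorffMeasure_le_liminf_tsum (ι := fun p => {j // w ∈ M p j}) (m - 1)
      (hyperplaneSlice A w) (l := Filter.atTop) _ hr' (fun p j => t p j)
      (Filter.Eventually.of_forall fun p j => htr p j)
      (Filter.Eventually.of_forall fun p q hq => by
        obtain ⟨j, hj⟩ := Set.mem_iUnion.1 (hAt p hq.1)
        exact Set.mem_iUnion.2 ⟨⟨j, subset_toMeasurable _ _ ⟨q, hj, hq.2⟩⟩, hj⟩)
    refine this.trans_eq ?_
    congr 1
    ext p
    exact tsum_subtype {j | w ∈ M p j} (fun j => ediam (t p j) ^ (m - 1))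
  · refine (lintegral_liminf_le hf).trans ?_
    exact Filter.liminf_le_of_le (by isBoundedDefault) fun b hb => by
      obtain ⟨p, hp⟩ := hb.exists
      exact hp.trans (hfint p)

/-! ### Choice of poles and subsequences -/

/-- Normalizing a vector near a unit vector moves it by at most twice the distance. -/
theorem dist_normalize_lt {n : ℕ} (u : USphere n) {w : Eucl n} {ε : ℝ}
    (hw : dist w u < ε) (hw0 : w ≠ 0) : dist (‖w‖⁻¹ • w) (u : Eucl n) < 2 * ε := by
  have h1 : ‖(u : Eucl n)‖ = 1 := norm_eq_of_mem_sphere u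
  have hpos : 0 < ‖w‖ := norm_pos_iff.2 hw0
  have h2 : dist (‖w‖⁻¹ • w) w ≤ dist w u := by
    rw [dist_eq_norm, dist_eq_norm]
    have : ‖w‖⁻¹ • w - w = (‖w‖⁻¹ - 1) • w := by rw [sub_smul, one_smul]
    rw [this, norm_smul, Real.norm_eq_abs, ← abs_of_pos hpos, ← abs_mul, abs_of_pos hpos, sub_mul,
      inv_mul_cancel₀ hpos.ne', one_mul, abs_sub_comm]
    simpa only [h1] using abs_norm_sub_norm_le w (u : Eucl n)
  linarith [dist_triangle (‖w‖⁻¹ • w) w (u : Eucl n)]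

/-- One slicing step: finitely many sequences of sets of bounded measure have, along a common
subsequence, slices of bounded measure over a great sphere whose pole is close to a given one. -/
theorem exists_pole_subseq_slice_le {n : ℕ} {ι : Type*} (s : Finset ι) (m : ι → ℝ)
    (hm : ∀ a ∈ s, 1 ≤ m a) (A : ι → ℕ → Set (SphereBundle n)) (C : ℝ≥0)
    (hA : ∀ a ∈ s, ∀ i, μH[m a] (A a i) ≤ C) (u : USphere n) {ε : ℝ} (hε : 0 < ε) :
    ∃ v : USphere n, dist v u < ε ∧ ∃ φ : ℕ → ℕ, StrictMono φ ∧ ∃ D : ℝ≥0,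
      ∀ a ∈ s, ∀ i, μH[m a - 1] (pullBack (A a (φ i)) (greatSphere v)) ≤ D := by
  choose! h hmeas hle hint using fun a (ha : a ∈ s) i =>
    exists_slice_majorant u (hm a ha) (hA a ha i)
  let F : ℕ → Eucl n → ℝ≥0∞ := fun i w => ∑ a ∈ s, h a i w
  have hF : ∀ i, Measurable (F i) := fun i => Finset.measurable_fun_sum _ fun a ha => hmeas a ha i
  have hFint : ∀ i, ∫⁻ w in ball (u : Eucl n) 1, F i w ≤ s.card • (4 ^ n * ((C : ℝ≥0∞) + 1)) := by
    intro i
    simp only [F]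
    rw [lintegral_finsetSum' _ fun a ha => (hmeas a ha i).aemeasurable]
    exact Finset.sum_le_card_nsmul _ _ _ fun a ha => hint a ha i
  have hlim : ∫⁻ w in ball (u : Eucl n) 1, Filter.liminf (fun i => F i w) Filter.atTop ≠ ⊤ := by
    refine ne_top_of_le_ne_top (b := s.card • (4 ^ n * ((C : ℝ≥0∞) + 1))) ?_
      ((lintegral_liminf_le hF).trans ?_)
    · rw [nsmul_eq_mul]
      exact ENNReal.mul_ne_top (ENNReal.natCast_ne_top _) (ENNReal.mul_ne_top
        (ENNReal.pow_ne_top (by norm_num)) (by simp))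
    · exact Filter.liminf_le_of_le (by isBoundedDefault) fun b hb => by
        obtain ⟨p, hp⟩ := hb.exists
        exact hp.trans (hFint p)
  have hae := ae_lt_top (Measurable.liminf hF) hlim
  have h1 : ‖(u : Eucl n)‖ = 1 := norm_eq_of_mem_sphere u
  -- Normalizing at most doubles the distance to `u`, hence `ε / 2`; radius `1` stays in the domain
  -- of integration and excludes `0`.
  set δ := min (ε / 2) 1 with hδ
  have hδ0 : 0 < δ := lt_min (half_pos hε) one_pos
  have hsub : ball (u : Eucl n) δ ⊆ ball (u : Eucl n) 1 := ball_subset_ball (min_le_right _ _)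
  obtain ⟨w, hw, hwfin⟩ : ∃ w ∈ ball (u : Eucl n) δ,
      Filter.liminf (fun i => F i w) Filter.atTop < ⊤ := by
    by_contra! hcon
    have h0 : volume (ball (u : Eucl n) δ) = 0 := by
      have hae' := ae_restrict_of_ae_restrict_of_subset hsub hae
      rw [ae_restrict_iff' measurableSet_ball, ae_iff] at hae'
      refine measure_mono_null (fun w hw => ?_) hae'
      simp only [Set.mem_ofPred_eq, not_forall]
      exact ⟨hw, not_lt.2 (hcon w hw)⟩
    exact (measure_ball_pos volume (u : Eucl n) hδ0).ne' h0
  have hw0 : w ≠ 0 := by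
    rintro rfl
    have := hsub hw
    rw [mem_ball, dist_zero_left, h1] at this
    exact lt_irrefl _ this
  obtain ⟨D, hD, -⟩ := ENNReal.lt_iff_exists_nnreal_btwn.1 hwfin
  obtain ⟨φ, hφ, hφD⟩ := Filter.extraction_of_frequently_atTop
    (Filter.frequently_lt_of_liminf_lt (by isBoundedDefault) hD)
  have hnorm : ‖‖w‖⁻¹ • w‖ = 1 := norm_smul_inv_norm hw0
  refine ⟨⟨‖w‖⁻¹ • w, mem_sphere_zero_iff_norm.2 hnorm⟩, ?_, φ, hφ, D, fun a ha i => ?_⟩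
  · have h2 := dist_normalize_lt u (mem_ball.1 hw) hw0
    refine lt_of_lt_of_le (by exact h2) ?_
    linarith [min_le_left (ε / 2) 1]
  · have hs : pullBack (A a (φ i)) (greatSphere ⟨‖w‖⁻¹ • w, mem_sphere_zero_iff_norm.2 hnorm⟩) ⊆
        hyperplaneSlice (A a (φ i)) w := by
      rintro p ⟨hp, hpw⟩
      refine ⟨hp, ?_⟩
      have hpw' : inner ℝ (‖w‖⁻¹ • w) (bundleProj p : Eucl n) = 0 := hpw
      rw [real_inner_smul_left] at hpw'
      exact (mul_eq_zero.1 hpw').resolve_left (inv_ne_zero (norm_ne_zero_iff.2 hw0))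
    refine (measure_mono hs).trans ((hle a ha (φ i) w).trans (le_trans ?_ (hφD i).le))
    exact Finset.single_le_sum (f := fun a => h a (φ i) w) (fun _ _ => zero_le) ha

theorem greatIntersection_insert {n : ℕ} [DecidableEq (USphere n)] (v : USphere n)
    (W : Finset (USphere n)) :
    greatIntersection (insert v W) = greatIntersection W ∩ greatSphere v := by
  simp only [greatIntersection, Finset.set_biInter_insert, Set.inter_comm]

/-- Poles arbitrarily close to finitely many given ones, in general position with respect to a
subsequence of `E`. -/
theorem exists_poles_subseq_pullBack_le {n : ℕ} (E : ℕ → Set (SphereBundle n))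
    (hE : ∃ L : ℝ≥0, ∀ i, μH[(n : ℝ) - 1] (E i) ≤ L) {ε : ℝ} (hε : 0 < ε)
    (T : Finset (USphere n)) :
    ∃ V : Finset (USphere n), (∀ u ∈ T, ∃ v ∈ V, dist v u < ε) ∧
      ∃ φ : ℕ → ℕ, StrictMono φ ∧ ∃ C : ℝ≥0, ∀ W ⊆ V, W.card + 1 ≤ n → ∀ i,
        μH[(n : ℝ) - 1 - W.card] (pullBack (E (φ i)) (greatIntersection W)) ≤ C := by
  classical
  induction T using Finset.induction_on with
  | empty =>
    obtain ⟨L, hL⟩ := hE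
    refine ⟨∅, by simp, id, strictMono_id, L, fun W hW _ i => ?_⟩
    rw [Finset.subset_empty.1 hW]
    simpa using (measure_mono (show pullBack (E i) (greatIntersection ∅) ⊆ E i from
      Set.inter_subset_left)).trans (hL i)
  | insert u T _ ih =>
    obtain ⟨V, hTV, φ, hφ, C, hC⟩ := ih
    obtain ⟨v, hvu, ψ, hψ, D, hD⟩ := exists_pole_subseq_slice_le
      -- These are the intersections whose dimension is still at least `1`, so that they can be
      -- sliced again.
      (V.powerset.filter fun W => W.card + 2 ≤ n) (fun W => (n : ℝ) - 1 - W.card)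
      (fun W hW => by
        have : ((W.card + 2 : ℕ) : ℝ) ≤ n := Nat.cast_le.2 (Finset.mem_filter.1 hW).2
        push_cast at this
        linarith)
      (fun W i => pullBack (E (φ i)) (greatIntersection W)) C
      (fun W hW i => by
        rw [Finset.mem_filter, Finset.mem_powerset] at hW
        exact hC W hW.1 (by omega) i) u hε
    refine ⟨insert v V, ?_, φ ∘ ψ, hφ.comp hψ, max C D, fun W hW hcard i => ?_⟩
    · intro x hx
      obtain rfl | hx := Finset.mem_insert.1 hx
      · exact ⟨v, Finset.mem_insert_self _ _, hvu⟩
      · obtain ⟨y, hy, hyx⟩ := hTV x hx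
        exact ⟨y, Finset.mem_insert_of_mem hy, hyx⟩
    · by_cases hv : v ∈ W
      · have hcard' := Finset.card_erase_add_one hv
        have hD' := hD (W.erase v) (by
          rw [Finset.mem_filter, Finset.mem_powerset]
          exact ⟨Finset.subset_insert_iff.1 hW, by omega⟩) i
        have h1 : pullBack (E ((φ ∘ ψ) i)) (greatIntersection W) =
            pullBack (pullBack (E (φ (ψ i))) (greatIntersection (W.erase v))) (greatSphere v) := by
          conv_lhs => rw [← Finset.insert_erase hv, greatIntersection_insert]
          simp only [pullBack, Set.preimage_inter, Set.inter_assoc, Function.comp]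
        have h2 : (n : ℝ) - 1 - W.card = (n : ℝ) - 1 - (W.erase v).card - 1 := by
          rw [← hcard']; push_cast; ring
        rw [h1, h2]
        exact hD'.trans (by simp)
      · exact (hC W ((Finset.subset_insert_iff_of_notMem hv).1 hW) hcard (ψ i)).trans (by simp)

/-! ### Size of the cells -/

theorem exists_finite_net {n : ℕ} {ε : ℝ} (hε : 0 < ε) :
    ∃ T : Finset (USphere n), ∀ x : USphere n, ∃ u ∈ T, dist x u < ε := by
  obtain ⟨t, -, ht, hcov⟩ := finite_cover_balls_of_compact (isCompact_univ (X := USphere n)) hε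
  refine ⟨ht.toFinset, fun x => ?_⟩
  obtain ⟨u, hu, hxu⟩ := Set.mem_iUnion₂.1 (hcov (Set.mem_univ x))
  exact ⟨u, ht.mem_toFinset.2 hu, hxu⟩

/-- Two points in the same cell lie on the same side of every great sphere of the skeleton. -/
theorem inner_pos_of_mem_cell {n : ℕ} {V : Finset (USphere n)} {c : Set (USphere n)}
    (hc : c ∈ skeletonCells (greatSkeleton V)) {x y : USphere n} (hx : x ∈ c) (hy : y ∈ c)
    {v : USphere n} (hv : v ∈ V) (h : 0 < inner ℝ (v : Eucl n) (x : Eucl n)) :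
    0 < inner ℝ (v : Eucl n) (y : Eucl n) := by
  obtain ⟨z, -, rfl⟩ := hc
  by_contra! hneg
  have hcont : ContinuousOn (fun q : USphere n => inner ℝ (v : Eucl n) (q : Eucl n))
      (connectedComponentIn (greatSkeleton V)ᶜ z) := by fun_prop
  obtain ⟨q, hq, hq0⟩ := isPreconnected_connectedComponentIn.intermediate_value hy hx hcont
    ⟨hneg, h.le⟩
  exact connectedComponentIn_subset _ _ hq (Set.mem_iUnion₂.2 ⟨v, hv, hq0⟩)

theorem geodesicDiam_cell_lt_one {n : ℕ} {V : Finset (USphere n)}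
    (hV : ∀ x : USphere n, ∃ v ∈ V, dist (v : Eucl n) x < 1 / 4) {c : Set (USphere n)}
    (hc : c ∈ skeletonCells (greatSkeleton V)) : geodesicDiam c < 1 := by
  have hang : ∀ x ∈ c, ∀ y ∈ c,
      InnerProductGeometry.angle (x : Eucl n) (y : Eucl n) ≤ Real.pi / 4 := by
    intro x hx y hy
    have hx1 : ‖(x : Eucl n)‖ = 1 := norm_eq_of_mem_sphere x
    have hy1 : ‖(y : Eucl n)‖ = 1 := norm_eq_of_mem_sphere y
    have hsq : ‖(x : Eucl n) - y‖ ^ 2 = 2 - 2 * inner ℝ (x : Eucl n) (y : Eucl n) := by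
      rw [norm_sub_sq_real, hx1, hy1]; ring
    have hd : ‖(x : Eucl n) - y‖ < 1 / 2 := by
      by_contra! hd
      have hpos : 0 < ‖(x : Eucl n) - y‖ := by linarith
      set d := ‖(x : Eucl n) - y‖ with hdd
      have hz : ‖d⁻¹ • ((x : Eucl n) - y)‖ = 1 :=
        norm_smul_inv_norm (norm_pos_iff.1 hpos)
      -- The unit vector along `x - y` has inner products `± d / 2` with `x` and `y`, of size at
      -- least `1 / 4`; a pole closer than `1 / 4` keeps both signs and separates them.
      obtain ⟨v, hv, hvz⟩ := hV ⟨d⁻¹ • ((x : Eucl n) - y), mem_sphere_zero_iff_norm.2 hz⟩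
      simp only [dist_eq_norm] at hvz
      set z := d⁻¹ • ((x : Eucl n) - y) with hzdef
      have hxx : inner ℝ (x : Eucl n) (x : Eucl n) = 1 := by
        rw [real_inner_self_eq_norm_sq, hx1]; norm_num
      have hyy : inner ℝ (y : Eucl n) (y : Eucl n) = 1 := by
        rw [real_inner_self_eq_norm_sq, hy1]; norm_num
      have hzx : inner ℝ z (x : Eucl n) = d / 2 := by
        rw [hzdef, real_inner_smul_left, inner_sub_left, hxx, real_inner_comm]
        field_simp
        linarith
      have hzy : inner ℝ z (y : Eucl n) = -(d / 2) := by
        rw [hzdef, real_inner_smul_left, inner_sub_left, hyy]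
        field_simp
        linarith
      have hvx : 0 < inner ℝ (v : Eucl n) (x : Eucl n) := by
        have := abs_le.1 (abs_real_inner_le_norm ((v : Eucl n) - z) (x : Eucl n))
        rw [hx1, inner_sub_left, hzx] at this
        linarith [this.1]
      have hvy : inner ℝ (v : Eucl n) (y : Eucl n) < 0 := by
        have := abs_le.1 (abs_real_inner_le_norm ((v : Eucl n) - z) (y : Eucl n))
        rw [hy1, inner_sub_left, hzy] at this
        linarith [this.2]
      exact hvy.not_gt (inner_pos_of_mem_cell hc hx hy hv hvx)
    have hcos : 7 / 8 ≤ inner ℝ (x : Eucl n) (y : Eucl n) := by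
      nlinarith [norm_nonneg ((x : Eucl n) - y)]
    rw [InnerProductGeometry.angle, hx1, hy1, mul_one, div_one, ← Real.arccos_cos
      (by positivity : 0 ≤ Real.pi / 4) (by linarith [Real.pi_pos])]
    refine Real.arccos_le_arccos ?_
    rw [Real.cos_pi_div_four]
    have : √2 ≤ 7 / 4 := Real.sqrt_le_iff.2 (by norm_num)
    linarith
  calc geodesicDiam c ≤ ENNReal.ofReal (Real.pi / 4) :=
        iSup₂_le fun x hx => iSup₂_le fun y hy => ENNReal.ofReal_le_ofReal (hang x hx y hy)
    _ < 1 := by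
        rw [ENNReal.ofReal_lt_one]
        linarith [Real.pi_lt_four]

/-! ### Codimension and conclusion -/

/-- An intersection of great spheres is already cut out by as many of them as its codimension. -/
theorem exists_subset_card_eq_greatCodim {n : ℕ} (W : Finset (USphere n)) :
    ∃ W' ⊆ W, W'.card = greatCodim W ∧ greatIntersection W' = greatIntersection W := by
  classical
  obtain ⟨t, hts, hcard, hspan, -⟩ := Submodule.exists_finset_span_eq_linearIndepOn ℝ
    ((fun v : USphere n => (v : Eucl n)) '' (W : Set (USphere n)))
  obtain ⟨W', hW', rfl⟩ := Finset.subset_set_image_iff.1 hts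
  refine ⟨W', Finset.coe_subset.1 hW', ?_, ?_⟩
  · rwa [Finset.card_image_of_injective _ Subtype.val_injective] at hcard
  · refine Set.Subset.antisymm (fun x hx => ?_)
      (Set.biInter_subset_biInter_left fun v hv => Finset.coe_subset.1 hW' hv)
    have hle : Submodule.span ℝ ((W'.image fun v : USphere n => (v : Eucl n) : Finset (Eucl n)) :
        Set (Eucl n)) ≤ (Submodule.span ℝ {(x : Eucl n)})ᗮ := by
      refine Submodule.span_le.2 fun w hw => ?_
      obtain ⟨v, hv, rfl⟩ := Finset.mem_image.1 (Finset.mem_coe.1 hw)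
      rw [SetLike.mem_coe, Submodule.mem_orthogonal_singleton_iff_inner_left]
      exact Set.mem_iInter₂.1 hx v hv
    refine Set.mem_iInter₂.2 fun v hv => ?_
    have hvs : (v : Eucl n) ∈ Submodule.span ℝ
        ((fun v : USphere n => (v : Eucl n)) '' (W : Set (USphere n))) :=
      Submodule.subset_span ⟨v, hv, rfl⟩
    rw [← hspan] at hvs
    exact Submodule.mem_orthogonal_singleton_iff_inner_left.1 (hle hvs)

theorem lemma5p2 (n : ℕ) (hn : 2 ≤ n) (E : ℕ → Set (SphereBundle n))
    (hE : ∃ L : ℝ≥0, ∀ i, μH[(n : ℝ) - 1] (E i) ≤ L) :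
    ∃ V : Finset (USphere n),
      (∀ c ∈ skeletonCells (greatSkeleton V), geodesicDiam c < 1) ∧
      ∃ φ : ℕ → ℕ, StrictMono φ ∧
      ∃ C : ℝ≥0,
        (∀ i, μH[(n : ℝ) - 2] (pullBack (E (φ i)) (greatSkeleton V)) ≤ C) ∧
        ∀ W ⊆ V, ∀ k : ℕ, 1 ≤ k → k ≤ n - 1 → greatCodim W = k →
          ∀ i, μH[(n : ℝ) - 1 - k] (pullBack (E (φ i)) (greatIntersection W)) ≤ C := by
  obtain ⟨T, hT⟩ := exists_finite_net (n := n) (ε := 1 / 8) (by norm_num)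
  obtain ⟨V, hTV, φ, hφ, C, hC⟩ :=
    exists_poles_subseq_pullBack_le E hE (ε := 1 / 8) (by norm_num) T
  refine ⟨V, fun c hc => geodesicDiam_cell_lt_one (fun x => ?_) hc, φ, hφ,
    -- The skeleton is a union of `V.card` great spheres, each the case of a single pole, which is
    -- where `2 ≤ n` enters.
    max (V.card * C) C, fun i => ?_, fun W hW k hk1 hk hWk i => ?_⟩
  · obtain ⟨u, hu, hxu⟩ := hT x
    obtain ⟨v, hv, hvu⟩ := hTV u hu
    refine ⟨v, hv, ?_⟩
    have : dist v x ≤ dist v u + dist x u := dist_triangle_right v x u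
    exact lt_of_le_of_lt (by exact this) (by linarith)
  · have hsub : pullBack (E (φ i)) (greatSkeleton V) ⊆
        ⋃ v ∈ V, pullBack (E (φ i)) (greatSphere v) := by
      rintro p ⟨hp, hpv⟩
      obtain ⟨v, hv, hpv⟩ := Set.mem_iUnion₂.1 hpv
      exact Set.mem_iUnion₂.2 ⟨v, hv, hp, hpv⟩
    refine (measure_mono hsub).trans ((measure_biUnion_finset_le _ _).trans ?_)
    refine (Finset.sum_le_card_nsmul _ _ (C : ℝ≥0∞) fun v hv => ?_).trans ?_
    · have := hC {v} (Finset.singleton_subset_iff.2 hv) (by simpa using hn) i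
      have h2 : (n : ℝ) - 1 - (({v} : Finset (USphere n)).card : ℕ) = n - 2 := by
        rw [Finset.card_singleton]; push_cast; ring
      rw [h2] at this
      simpa [greatIntersection] using this
    · rw [nsmul_eq_mul]
      exact_mod_cast le_max_left _ _
  · obtain ⟨W', hW', hcard, hint⟩ := exists_subset_card_eq_greatCodim W
    rw [hWk] at hcard
    have := hC W' (hW'.trans hW) (by omega) i
    rw [hint, hcard] at this
    exact this.trans (by exact_mod_cast le_max_right _ _)
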